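/- A planar map geometry $(M,\mu)$ consists of a finite connected graph $M$ (loops and multiple edges allowed) embedded in the Euclidean plane, every vertex $v$ of which has valency $\rho_M(v)\ge 3$, an angle factor $\mu(v)$ with $0<\mu(v)<4\pi/\rho_M(v)$ at each vertex $v$, and, on each edge, a smooth monotone angle function whose value at each end $v$ of the edge is $\rho_M(v)\mu(v)/2$. For a point $p$ of the plane let $f(p)$ be the value at $p$ of the angle function of the edge through $p$ if $p$ lies on $M$ (so $f(v)=\rho_M(v)\mu(v)/2$ at a vertex $v$), and $f(p)=\pi$ if $p$ does not lie on $M$. The point $p$ is called non-euclidean if $f(p)\neq\pi$. An $m$-line is a directed curve in the plane that consists of straight pieces (locally at each of its points it is a unit-speed broken line) and whose angle at each of its points $p$, measured on the left side, that is clockwise from the entering to the leaving ray, equals $f(p)$; in particular it is straight inside each face of $M$. It is simply closed if it returns to its initial point and has no self-intersections. The curvature of an $m$-line $L$ is $\omega(L)=\sum_{p\in W}(\pi-f(p))$, where $W$ is the set of non-euclidean points on $L$. Theorem. Let $(M,\mu)$ be a planar map geometry and let $L$ be a simply closed $m$-line, directed so that the region it encloses is on its left (so that the values of $f$ along $L$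 are the interior angles of $L$). Let $x_1,\dots,x_n$ be the distinct non-euclidean points through which $L$ passes. Then $$\omega(L)=\sum_{i=1}^n(\pi-f(x_i))=2\pi.$$ -/

import Mathlib

noncomputable section

/-- A planar map: a finite connected graph (loops and multiple edges allowed) drawn in the plane
`ℂ`.  The edge `e` is the arc `arc e : [0, 1] → ℂ`, which joins the vertices `arc e 0` and
`arc e 1`, does not cross itself, and meets the vertices and the other edges in its ends only. -/
structure PlanarMap where
  V : Finset ℂ
  numEdges : ℕ
  arc : Fin numEdges → ℝ → ℂ
  continuousOn_arc : ∀ e, ContinuousOn (arc e) (Set.Icc 0 1)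
  arc_zero_mem : ∀ e, arc e 0 ∈ V
  arc_one_mem : ∀ e, arc e 1 ∈ V
  arc_notMem : ∀ e, ∀ t ∈ Set.Ioo (0 : ℝ) 1, arc e t ∉ V
  arc_injOn : ∀ e, Set.InjOn (arc e) (Set.Ioo 0 1)
  arc_disjoint : ∀ e e', e ≠ e' → ∀ t ∈ Set.Ioo (0 : ℝ) 1, ∀ t' ∈ Set.Ioo (0 : ℝ) 1,
    arc e t ≠ arc e' t'
  isConnected : IsConnected ((V : Set ℂ) ∪ ⋃ e, arc e '' Set.Icc 0 1)

/-- The valency `ρ_M(v)` of a vertex: the number of edge ends at `v` (a loop counts twice). -/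
def PlanarMap.valency (M : PlanarMap) (v : ℂ) : ℕ :=
  {e | M.arc e 0 = v}.ncard + {e | M.arc e 1 = v}.ncard

/-- A planar map geometry `(M, μ)`: a planar map all of whose vertices have valency at least `3`,
with an angle factor `0 < μ(v) < 4π / ρ_M(v)` at each vertex `v`, and, on each edge, a smooth
monotone angle function with value `ρ_M(v) μ(v) / 2` at each end `v` of the edge. -/
structure PlanarMapGeometry extends PlanarMap where
  three_le_valency : ∀ v ∈ V, 3 ≤ toPlanarMap.valency v
  μ : ℂ → ℝ
  μ_pos : ∀ v ∈ V, 0 < μ v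
  μ_lt : ∀ v ∈ V, μ v < 4 * Real.pi / toPlanarMap.valency v
  edgeAngle : Fin numEdges → ℝ → ℝ
  contDiffOn_edgeAngle : ∀ e, ContDiffOn ℝ (⊤ : ℕ∞) (edgeAngle e) (Set.Icc 0 1)
  monotone_edgeAngle : ∀ e,
    MonotoneOn (edgeAngle e) (Set.Icc 0 1) ∨ AntitoneOn (edgeAngle e) (Set.Icc 0 1)
  edgeAngle_zero : ∀ e, edgeAngle e 0 = toPlanarMap.valency (arc e 0) * μ (arc e 0) / 2
  edgeAngle_one : ∀ e, edgeAngle e 1 = toPlanarMap.valency (arc e 1) * μ (arc e 1) / 2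

namespace PlanarMapGeometry

open Classical in
/-- The angle function value `f(p)` at a point `p` of the plane: `ρ_M(p) μ(p) / 2` at a vertex,
the value of the angle function of the edge at an inner point of an edge, and `π` off the map. -/
def angle (G : PlanarMapGeometry) (p : ℂ) : ℝ :=
  if p ∈ G.V then G.valency p * G.μ p / 2
  else if h : ∃ x : Fin G.numEdges × ℝ, x.2 ∈ Set.Ioo (0 : ℝ) 1 ∧ G.arc x.1 x.2 = p then
    G.edgeAngle h.choose.1 h.choose.2
  else Real.pi

/-- The function `angle` extends the angle functions of all edges. -/
theorem angle_arc (G : PlanarMapGeometry) (e : Fin G.numEdges) {t : ℝ}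
    (ht : t ∈ Set.Icc (0 : ℝ) 1) : G.angle (G.arc e t) = G.edgeAngle e t := by
  rcases eq_or_lt_of_le ht.1 with h0 | h0
  · subst h0
    rw [angle, if_pos (G.arc_zero_mem e), G.edgeAngle_zero]
  rcases eq_or_lt_of_le ht.2 with h1 | h1
  · subst h1
    rw [angle, if_pos (G.arc_one_mem e), G.edgeAngle_one]
  have hex : ∃ x : Fin G.numEdges × ℝ, x.2 ∈ Set.Ioo (0 : ℝ) 1 ∧ G.arc x.1 x.2 = G.arc e t :=
    ⟨(e, t), ⟨h0, h1⟩, rfl⟩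
  rw [angle, if_neg (G.arc_notMem e t ⟨h0, h1⟩), dif_pos hex]
  have hs := hex.choose_spec
  generalize hex.choose = x at hs ⊢
  obtain ⟨e', t'⟩ := x
  have he : e' = e := by
    by_contra hne
    exact G.arc_disjoint e' e hne t' hs.1 t ⟨h0, h1⟩ hs.2
  subst he
  rw [G.arc_injOn e' hs.1 ⟨h0, h1⟩ hs.2]

/-- A point is non-euclidean (elliptic or hyperbolic) if its angle function value is not `π`. -/
def IsNonEuclidean (G : PlanarMapGeometry) (p : ℂ) : Prop :=
  G.angle p ≠ Real.pi

end PlanarMapGeometry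

/-- The directed curve `γ` is, near the parameter `t`, a unit speed broken line: it leaves `γ t`
in the direction of the unit vector `a`, and it comes in along the ray that `a` reaches after a
counterclockwise rotation by `θ`.  So `θ ∈ (0, 2π)` is the angle of `γ` at `γ t` on its left
side (measured clockwise from the entering to the leaving ray); `θ = π` if and only if `γ` is
straight near `t`. -/
def HasCorner (γ : ℝ → ℂ) (t : ℝ) (a : ℂ) (θ : ℝ) : Prop :=
  ‖a‖ = 1 ∧ 0 < θ ∧ θ < 2 * Real.pi ∧ ∃ ε > 0, ∀ s : ℝ, 0 ≤ s → s ≤ ε →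
    γ (t + s) = γ t + s * a ∧ γ (t - s) = γ t + s * (Complex.exp (θ * Complex.I) * a)

/-- An `m`-line of a planar map geometry: a directed curve that consists of straight pieces, and
whose angle at each of its points is the angle function value there.  In particular it is
straight in the faces of the map, and it has the angle `ρ_M(v) μ(v) / 2` at a vertex `v`. -/
def IsMLine (G : PlanarMapGeometry) (γ : ℝ → ℂ) : Prop :=
  ∀ t, ∃ a, HasCorner γ t a (G.angle (γ t))

/-- A curve is simply closed if it comes back to its initial point and has no
self-intersections. -/
def IsSimplyClosed (γ : ℝ → ℂ) : Prop :=
  ∃ T > 0, Function.Periodic γ T ∧ ∀ s t, γ s = γ t → ∃ k : ℤ, t = s + k * T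

/-- The points enclosed by a curve: those off the curve that lie in a bounded connected component
of its complement. -/
def enclosed (γ : ℝ → ℂ) : Set ℂ :=
  {z | z ∉ Set.range γ ∧ Bornology.IsBounded (connectedComponentIn (Set.range γ)ᶜ z)}

/-- The left side of the curve is its inner side, so that the angles of the curve are its interior
angles: the sector of each angle is, close to its apex, contained in the enclosed region. -/
def HasInteriorAngles (γ : ℝ → ℂ) : Prop :=
  ∀ t a θ, HasCorner γ t a θ → ∃ r > 0, ∀ s φ : ℝ, 0 < s → s < r → 0 < φ → φ < θ →
    γ t + s * (Complex.exp (φ * Complex.I) * a) ∈ enclosed γ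

/-- The set of non-euclidean points on the curve `γ`. -/
def nonEuclideanPoints (G : PlanarMapGeometry) (γ : ℝ → ℂ) : Set ℂ :=
  {p | p ∈ Set.range γ ∧ G.IsNonEuclidean p}

/-- The curvature `ω(L)` of an `m`-line: the sum of `π - f(p)` over its non-euclidean points. -/
def curvature (G : PlanarMapGeometry) (γ : ℝ → ℂ) : ℝ :=
  ∑ᶠ p ∈ nonEuclideanPoints G γ, (Real.pi - G.angle p)

end

open Filter Topology Set

/-! The geometry enters only through its angles: this is Hopf's Umlaufsatz for a closed polygon,
proved with chords. On the strip `0 < ε < T` the chord from `γ s` to `γ (s + ε)` never vanishes, so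
it has a continuous logarithm `F`. For short chords, `(F (s, ε)).im` is an argument `ψ s` of the
leaving direction at `s`; it is locally constant except at corners, where it grows by `π - θ`
(`HasCorner.exists_im_log_chord`). Hence its growth over one period is the sum of exterior angles
(`sub_eq_sum_jumps`). That growth is also found globally. Exchanging the ends of a chord negates it,
so it adds one and the same constant to `F` everywhere, and two exchanges shift `s` by a period. The
imaginary part of the constant is read off at a lowest point of the curve, where all chords avoid
the downward direction and the interior lies above (`HasCorner.arg_entering_of_isLowest`). It is
`π`, so the total is `2π`. -/

/-! ### Continuous logarithms and step functions. -/

/-- A continuous function on a preconnected set whose exponential is constant is constant. -/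
theorem IsPreconnected.eq_of_cexp_eq {X : Type*} [TopologicalSpace X] {S : Set X}
    (hS : IsPreconnected S) {f : X → ℂ} (hf : ContinuousOn f S) {w : ℂ}
    (hw : ∀ x ∈ S, Complex.exp (f x) = w) {x y : X} (hx : x ∈ S) (hy : y ∈ S) : f x = f y := by
  refine (Complex.isCoveringMap_exp.isSeparatedMap.eqOn_of_comp_eqOn
    Complex.isCoveringMap_exp.isLocalHomeomorph.isLocallyInjective hS hf
    (continuousOn_const (c := f y)) ?_ hy rfl) hx
  intro z hz
  simp [hw z hz, hw y hy]

/-- A nonvanishing continuous function on a convex open set of the plane has a continuous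
logarithm. -/
theorem exists_continuousOn_log {U : Set (ℝ × ℝ)} (hU : IsOpen U) (hc : Convex ℝ U)
    (hne : U.Nonempty) {D : ℝ × ℝ → ℂ} (hD : ContinuousOn D U) (h0 : ∀ p ∈ U, D p ≠ 0) :
    ∃ F : ℝ × ℝ → ℂ, ContinuousOn F U ∧ ∀ p ∈ U, Complex.exp (F p) = D p := by
  obtain ⟨p₀, hp₀⟩ := hne
  have := hc.contractibleSpace ⟨p₀, hp₀⟩
  have := hU.locallyPathConnectedSpace
  obtain ⟨F, ⟨-, hF⟩, -⟩ := Complex.isCoveringMapOn_exp.existsUnique_continuousMap_lifts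
    (⟨fun p : U => D p, hD.domRestrict⟩ : C(U, ℂ)) (a₀ := ⟨p₀, hp₀⟩) (e₀ := Complex.log (D p₀))
    (Complex.exp_log (h0 p₀ hp₀)) (fun a => h0 a a.2)
  classical
  refine ⟨fun p => if h : p ∈ U then F ⟨p, h⟩ else 0, ?_, fun p hp => ?_⟩
  · rw [continuousOn_iff_continuous_domRestrict]
    convert F.continuous using 1
    ext p
    simp
  · have := congrFun hF ⟨p, hp⟩
    simp only [hp, dite_true]
    exact this

/-- A function on the line that is constant to the right of each point and jumps by `j t` when it
arrives at `t` from the left changes by the sum of its jumps. -/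
theorem sub_eq_sum_jumps {ψ j : ℝ → ℝ} {a b : ℝ} (hab : a ≤ b) (S : Finset ℝ)
    (hS : ∀ t ∈ S, t ∈ Ioc a b) (hj : ∀ t ∈ Ioc a b, t ∉ S → j t = 0)
    (hr : ∀ t, ∀ᶠ s in 𝓝[>] t, ψ s = ψ t) (hl : ∀ t, ∀ᶠ s in 𝓝[<] t, ψ s = ψ t - j t) :
    ψ b - ψ a = ∑ t ∈ S, j t := by
  -- `σ` collects the jumps in `(a, s]`, so it has the same one-sided behaviour as `ψ`. Then `ψ - σ`
  -- is continuous with right derivative zero, hence constant.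
  set σ : ℝ → ℝ := fun s => ∑ u ∈ S, if u ≤ s then j u else 0 with hσ
  have σr : ∀ t, ∀ᶠ s in 𝓝[>] t, σ s = σ t := by
    intro t
    have : ∀ᶠ s in 𝓝[>] t, ∀ u ∈ S, t < u → s < u := by
      rw [Finset.eventually_all]
      intro u _
      by_cases h : t < u
      · filter_upwards [nhdsWithin_le_nhds (Iio_mem_nhds h)] with s hs _ using hs
      · simp [h]
    filter_upwards [this, self_mem_nhdsWithin] with s hs hts
    refine Finset.sum_congr rfl fun u hu => ?_
    have : u ≤ s ↔ u ≤ t := ⟨fun h => not_lt.1 fun h' => absurd (hs u hu h') (not_lt.2 h),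
      fun h => h.trans (le_of_lt hts)⟩
    simp [this]
  have σl : ∀ t ∈ Ioc a b, ∀ᶠ s in 𝓝[<] t, σ s = σ t - j t := by
    intro t ht
    have : ∀ᶠ s in 𝓝[<] t, ∀ u ∈ S, u < t → u < s := by
      rw [Finset.eventually_all]
      intro u _
      by_cases h : u < t
      · filter_upwards [nhdsWithin_le_nhds (Ioi_mem_nhds h)] with s hs _ using hs
      · simp [h]
    filter_upwards [this, self_mem_nhdsWithin] with s hs hts
    have hjt : j t = ∑ u ∈ S, if t = u then j u else 0 := by
      rw [Finset.sum_ite_eq]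
      split_ifs with h
      · rfl
      · exact hj t ht h
    rw [hjt, hσ, ← Finset.sum_sub_distrib]
    refine Finset.sum_congr rfl fun u hu => ?_
    have hts : s < t := hts
    rcases lt_trichotomy u t with h | rfl | h
    · simp [h.le, h.ne', (hs u hu h).le]
    · simp [hts]
    · simp [h.not_ge, h.ne, (hts.trans h).not_ge]
  have key : ∀ x ∈ Icc a b, ψ x - σ x = ψ a - σ a := by
    refine constant_of_has_deriv_right_zero (f := fun x => ψ x - σ x) ?_ ?_
    · intro t ht
      have right : ContinuousWithinAt (fun x => ψ x - σ x) (Ioi t) t := by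
        refine (continuousWithinAt_const (b := ψ t - σ t)).congr_of_eventuallyEq ?_ rfl
        filter_upwards [hr t, σr t] with s h1 h2
        rw [h1, h2]
      rcases eq_or_lt_of_le ht.1 with rfl | hat
      · exact (continuousWithinAt_Ioi_iff_Ici.1 right).mono Icc_subset_Ici_self
      · have left : ContinuousWithinAt (fun x => ψ x - σ x) (Iio t) t := by
          refine (continuousWithinAt_const (b := ψ t - σ t)).congr_of_eventuallyEq ?_ rfl
          filter_upwards [hl t, σl t ⟨hat, ht.2⟩] with s h1 h2
          rw [h1, h2]; ring
        exact (continuousAt_iff_continuous_left'_right'.2 ⟨left, right⟩).continuousWithinAt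
    · intro t _
      refine (hasDerivWithinAt_Ioi_iff_Ici).1 ?_
      refine (hasDerivWithinAt_const t _ (ψ t - σ t)).congr_of_eventuallyEq ?_ rfl
      filter_upwards [hr t, σr t] with s h1 h2
      rw [h1, h2]
  have hb := key b ⟨hab, le_rfl⟩
  have hσb : σ b = ∑ t ∈ S, j t := Finset.sum_congr rfl fun u hu => by simp [(hS u hu).2]
  have hσa : σ a = 0 := Finset.sum_eq_zero fun u hu => by simp [(hS u hu).1]
  rw [hσb, hσa] at hb
  linarith

/-! ### Short chords near a corner. -/

namespace HasCorner

variable {γ : ℝ → ℂ} {t θ : ℝ} {a : ℂ}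

/-- One formula for both sides of the corner, so that chords straddling it need no case distinction.
-/
theorem exists_eq (h : HasCorner γ t a θ) : ∃ ε > 0, ∀ x, |x - t| ≤ ε →
    γ x = γ t + (max (x - t) 0 : ℝ) * a
      + (max (t - x) 0 : ℝ) * (Complex.exp (θ * Complex.I) * a) := by
  obtain ⟨-, -, -, ε, hε, h⟩ := h
  refine ⟨ε, hε, fun x hx => ?_⟩
  rw [abs_le] at hx
  rcases le_total t x with htx | htx
  · have := (h (x - t) (by linarith) (by linarith)).1
    rw [max_eq_left (by linarith), max_eq_right (by linarith)]
    simpa using this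
  · have := (h (t - x) (by linarith) (by linarith)).2
    rw [max_eq_right (by linarith), max_eq_left (by linarith)]
    simpa using this

theorem continuousAt (h : HasCorner γ t a θ) : ContinuousAt γ t := by
  obtain ⟨ε, hε, h⟩ := h.exists_eq
  have : γ =ᶠ[𝓝 t] fun x => γ t + (max (x - t) 0 : ℝ) * a
      + (max (t - x) 0 : ℝ) * (Complex.exp (θ * Complex.I) * a) := by
    filter_upwards [Metric.closedBall_mem_nhds t hε] with x hx
    exact h x (by simpa [Real.dist_eq] using hx)
  refine ContinuousAt.congr (Continuous.continuousAt ?_) this.symm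
  fun_prop

/-- Near a corner with interior angle `θ`, the argument of a short chord is constant before and
after the corner, and it grows by `π - θ` at the corner. -/
theorem exists_im_log_chord (h : HasCorner γ t a θ) (hγ : Continuous γ) {T : ℝ} (hT : 0 < T)
    {F : ℝ × ℝ → ℂ} (hF : ContinuousOn F (univ ×ˢ Ioo 0 T))
    (hexp : ∀ s ε, 0 < ε → ε < T → Complex.exp (F (s, ε)) = γ (s + ε) - γ s) :
    ∃ δ > 0, δ ≤ T ∧ ∃ C : ℝ, ∀ s ε, |s - t| < δ → 0 < ε → ε < δ →
      (t ≤ s → (F (s, ε)).im = C + (Real.pi - θ) / 2) ∧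
      (s + ε ≤ t → (F (s, ε)).im = C - (Real.pi - θ) / 2) := by
  obtain ⟨ε₀, hε₀, hγt⟩ := h.exists_eq
  obtain ⟨ha, hθ0, hθ2, -⟩ := h
  have ha0 : a ≠ 0 := by rintro rfl; simp at ha
  have hπ := Real.pi_pos
  -- Half the exterior angle, in `(-π/2, π/2)` because `0 < θ < 2π`.
  set β : ℝ := (Real.pi - θ) / 2 with hβ
  set u : ℂ := Complex.exp (β * Complex.I) with hu
  have hu0 : u ≠ 0 := Complex.exp_ne_zero _
  have huinv : u⁻¹ = Complex.exp ((-β : ℝ) * Complex.I) := by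
    rw [hu, ← Complex.exp_neg]; push_cast; ring_nf
  have hexpθ : Complex.exp (θ * Complex.I) = -(u⁻¹ * u⁻¹) := by
    rw [huinv, ← Complex.exp_add, ← neg_one_mul, ← Complex.exp_pi_mul_I, ← Complex.exp_add]
    congr 1
    rw [hβ]; push_cast; ring
  -- The direction halfway between arriving, `a * u⁻¹ * u⁻¹`, and leaving, `a`. Relative to `q`, a
  -- short chord is a nonnegative combination of `u⁻¹` and `u`, so it lies in the right half-plane
  -- and the principal logarithm applies.
  set q : ℂ := a * u⁻¹ with hq
  have hq0 : q ≠ 0 := mul_ne_zero ha0 (inv_ne_zero hu0)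
  set δ : ℝ := min (ε₀ / 2) T with hδ
  have hδ0 : 0 < δ := lt_min (by linarith) hT
  have hδε : δ ≤ ε₀ / 2 := min_le_left _ _
  have hδT : δ ≤ T := min_le_right _ _
  have chord : ∀ s ε, |s - t| < δ → 0 < ε → ε < δ → (γ (s + ε) - γ s) / q =
      ((max (s + ε - t) 0 - max (s - t) 0 : ℝ) : ℂ) * u +
        ((max (t - s) 0 - max (t - (s + ε)) 0 : ℝ) : ℂ) * u⁻¹ := by
    intro s ε hs h0 h1
    rw [abs_lt] at hs
    rw [hγt (s + ε) (abs_le.2 ⟨by linarith, by linarith⟩),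
      hγt s (abs_le.2 ⟨by linarith, by linarith⟩), hexpθ, hq]
    push_cast
    field_simp
    ring
  have slit : ∀ s ε, |s - t| < δ → 0 < ε → ε < δ →
      (γ (s + ε) - γ s) / q ∈ Complex.slitPlane := by
    intro s ε hs h0 h1
    rw [chord s ε hs h0 h1]
    left
    have hcos : 0 < Real.cos β := Real.cos_pos_of_mem_Ioo ⟨by linarith, by linarith⟩
    rw [Complex.add_re, Complex.re_ofReal_mul, Complex.re_ofReal_mul, huinv, hu,
      Complex.exp_ofReal_mul_I_re, Complex.exp_ofReal_mul_I_re, Real.cos_neg, ← add_mul]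
    refine mul_pos ?_ hcos
    have e1 := max_zero_sub_eq_self (s + ε - t)
    have e2 := max_zero_sub_eq_self (s - t)
    rw [neg_sub] at e1 e2
    linarith
  set R : Set (ℝ × ℝ) := Ioo (t - δ) (t + δ) ×ˢ Ioo 0 δ with hR
  have hRmem : ∀ p ∈ R, |p.1 - t| < δ ∧ 0 < p.2 ∧ p.2 < δ := by
    rintro p ⟨⟨h1, h2⟩, h3, h4⟩
    exact ⟨abs_lt.2 ⟨by linarith, by linarith⟩, h3, h4⟩
  have hRc : IsPreconnected R := isPreconnected_Ioo.prod isPreconnected_Ioo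
  have hGc : ContinuousOn
      (fun p : ℝ × ℝ => F p - Complex.log ((γ (p.1 + p.2) - γ p.1) / q)) R := by
    refine (hF.mono ?_).sub (ContinuousOn.clog ?_ ?_)
    · exact prod_mono (subset_univ _) (Ioo_subset_Ioo_right hδT)
    · exact Continuous.continuousOn (by fun_prop)
    · intro p hp
      obtain ⟨h1, h2, h3⟩ := hRmem p hp
      exact slit _ _ h1 h2 h3
  have hGexp : ∀ p ∈ R,
      Complex.exp (F p - Complex.log ((γ (p.1 + p.2) - γ p.1) / q)) = q := by
    intro p hp
    obtain ⟨h1, h2, h3⟩ := hRmem p hp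
    have hs := Complex.slitPlane_ne_zero (slit _ _ h1 h2 h3)
    rw [Complex.exp_sub, Complex.exp_log hs, hexp p.1 p.2 h2 (by linarith)]
    have : γ (p.1 + p.2) - γ p.1 ≠ 0 := fun h => hs (by rw [h, zero_div])
    field_simp
  have hmid : (t, δ / 2) ∈ R := ⟨⟨by simp [hδ0], by simp [hδ0]⟩, by simp [hδ0], by simp [hδ0]⟩
  set K : ℂ := F (t, δ / 2) - Complex.log ((γ (t + δ / 2) - γ t) / q) with hK
  have hconst : ∀ s ε, |s - t| < δ → 0 < ε → ε < δ →
      (F (s, ε)).im = K.im + Complex.arg ((γ (s + ε) - γ s) / q) := by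
    intro s ε hs h0 h1
    have hs' := abs_lt.1 hs
    have hp : (s, ε) ∈ R := ⟨⟨by simp; linarith, by simp; linarith⟩, h0, h1⟩
    have := hRc.eq_of_cexp_eq hGc hGexp hp hmid
    simp only [← hK] at this
    rw [← this, Complex.sub_im, Complex.log_im]
    ring
  refine ⟨δ, hδ0, hδT, K.im, fun s ε hs h0 h1 => ⟨fun hts => ?_, fun hst => ?_⟩⟩
  · rw [hconst s ε hs h0 h1, chord s ε hs h0 h1, max_eq_left (by linarith),
      max_eq_left (by linarith), max_eq_right (by linarith), max_eq_right (by linarith),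
      show s + ε - t - (s - t) = ε by ring, sub_self, Complex.ofReal_zero, zero_mul, add_zero,
      Complex.arg_real_mul _ h0, hu, Complex.exp_mul_I,
      Complex.arg_cos_add_sin_mul_I ⟨by linarith, by linarith⟩]
  · rw [hconst s ε hs h0 h1, chord s ε hs h0 h1, max_eq_right (by linarith),
      max_eq_right (by linarith), max_eq_left (by linarith), max_eq_left (by linarith),
      show t - s - (t - (s + ε)) = ε by ring, sub_self, Complex.ofReal_zero, zero_mul, zero_add,
      Complex.arg_real_mul _ h0, huinv, Complex.exp_mul_I,
      Complex.arg_cos_add_sin_mul_I ⟨by linarith, by linarith⟩]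
    ring

end HasCorner

/-! ### The lowest point of the curve. -/

namespace HasCorner

variable {γ : ℝ → ℂ} {t θ : ℝ} {a : ℂ}

/-- At a lowest point of a curve both rays point upwards. -/
theorem im_nonneg_of_isLowest (h : HasCorner γ t a θ) (hlow : ∀ s, (γ t).im ≤ (γ s).im) :
    0 ≤ a.im ∧ 0 ≤ (Complex.exp (θ * Complex.I) * a).im := by
  obtain ⟨-, -, -, ε, hε, h⟩ := h
  obtain ⟨h1, h2⟩ := h ε hε.le le_rfl
  have h3 := hlow (t + ε)
  have h4 := hlow (t - ε)
  rw [h1, Complex.add_im, Complex.im_ofReal_mul] at h3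
  rw [h2, Complex.add_im, Complex.im_ofReal_mul] at h4
  exact ⟨nonneg_of_mul_nonneg_right (by linarith) hε,
    nonneg_of_mul_nonneg_right (by linarith) hε⟩

end HasCorner

/-- Points strictly below a curve are not enclosed by it. -/
theorem notMem_enclosed_of_im_lt {γ : ℝ → ℂ} {z : ℂ} (hz : ∀ s, z.im < (γ s).im) :
    z ∉ enclosed γ := by
  rintro ⟨-, hb⟩
  have hsub : {w : ℂ | w.im ≤ z.im} ⊆ connectedComponentIn (range γ)ᶜ z := by
    refine IsPreconnected.subset_connectedComponentIn (convex_halfSpace_im_le z.im).isPreconnected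
      (le_refl z.im) ?_
    rintro w hw ⟨s, rfl⟩
    exact absurd (hz s) (not_lt.2 hw)
  obtain ⟨R, hR⟩ := (hb.subset hsub).exists_norm_le
  have hw := hR ⟨0, -(|z.im| + |R| + 1)⟩ (by
    have := neg_abs_le z.im
    have := abs_nonneg R
    simp only [mem_ofPred_eq]; linarith)
  have h2 := (Complex.abs_im_le_norm _).trans hw
  simp only [abs_neg] at h2
  have := le_abs_self (|z.im| + |R| + 1)
  have := le_abs_self R
  have := abs_nonneg z.im
  linarith

namespace HasCorner

variable {γ : ℝ → ℂ} {t θ : ℝ} {a : ℂ}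

/-- At a lowest point of a curve with interior angles, the entering ray is reached from the leaving
one without crossing the downward direction. -/
theorem arg_entering_of_isLowest (h : HasCorner γ t a θ) (hlow : ∀ s, (γ t).im ≤ (γ s).im)
    (hint : HasInteriorAngles γ) :
    Complex.arg (Complex.exp (θ * Complex.I) * a / Complex.I) =
      Complex.arg (a / Complex.I) + θ := by
  obtain ⟨hre, -⟩ := h.im_nonneg_of_isLowest hlow
  have hcorner := h
  obtain ⟨ha, hθ0, -, -⟩ := h
  -- Division by `I` turns the upward direction into `1` and puts the cut of `arg` along the
  -- downward direction.
  set α := Complex.arg (a / Complex.I) with hα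
  have hnorm : ‖a / Complex.I‖ = 1 := by simp [ha]
  have hpolar : a / Complex.I = Complex.exp (α * Complex.I) := by
    have := Complex.norm_mul_exp_arg_mul_I (a / Complex.I)
    rw [hnorm, Complex.ofReal_one, one_mul] at this
    exact this.symm
  have hα1 : |α| ≤ Real.pi / 2 :=
    Complex.abs_arg_le_pi_div_two_iff.2 (by simpa [Complex.div_I] using hre)
  rw [abs_le] at hα1
  have hπ := Real.pi_pos
  -- Otherwise the interior sector contains the downward direction, at rotation `π - α` from `a`,
  -- and so encloses points strictly below the curve.
  have hle : α + θ ≤ Real.pi := by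
    by_contra! hlt
    obtain ⟨r, hr, hsec⟩ := hint t a θ hcorner
    have hdown : Complex.exp ((Real.pi - α : ℝ) * Complex.I) * a = -Complex.I := by
      rw [(div_eq_iff Complex.I_ne_zero).1 hpolar, ← mul_assoc, ← Complex.exp_add, ← add_mul]
      push_cast
      rw [sub_add_cancel, Complex.exp_pi_mul_I, neg_one_mul]
    have hmem := hsec (r / 2) (Real.pi - α) (by linarith) (by linarith) (by linarith) (by linarith)
    rw [hdown] at hmem
    refine notMem_enclosed_of_im_lt (fun s => lt_of_lt_of_le ?_ (hlow s)) hmem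
    rw [Complex.add_im, Complex.im_ofReal_mul]
    simp
    linarith
  rw [mul_div_assoc, hpolar, ← Complex.exp_add, ← add_mul, ← Complex.ofReal_add, Complex.exp_mul_I,
    Complex.arg_cos_add_sin_mul_I ⟨by linarith, by linarith⟩, add_comm]

end HasCorner

/-! ### The total turning of a simply closed polygon. -/

/-- **Hopf's Umlaufsatz** for polygons: the exterior angles of a simply closed broken line whose
left side is its inner side add up to `2π`. -/
theorem exists_sum_exterior_angles_eq {γ : ℝ → ℂ} {a : ℝ → ℂ} {θ : ℝ → ℝ}
    (h : ∀ t, HasCorner γ t (a t) (θ t)) {T : ℝ} (hT : 0 < T) (hper : Function.Periodic γ T)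
    (hsimple : ∀ s t, γ s = γ t → ∃ k : ℤ, t = s + k * T) (hint : HasInteriorAngles γ) :
    ∃ t₀, ∀ S : Finset ℝ, (∀ t, t ∈ S ↔ t ∈ Ioc t₀ (t₀ + T) ∧ θ t ≠ Real.pi) →
      ∑ t ∈ S, (Real.pi - θ t) = 2 * Real.pi := by
  have hγ : Continuous γ := continuous_iff_continuousAt.2 fun t => (h t).continuousAt
  have hchord : ∀ s ε, 0 < ε → ε < T → γ (s + ε) - γ s ≠ 0 := by
    intro s ε h0 h1 heq
    obtain ⟨k, hk⟩ := hsimple s (s + ε) (sub_eq_zero.1 heq).symm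
    have hk' : ε = k * T := by linarith
    have k0 : (0 : ℝ) < k := by
      by_contra! hle
      nlinarith
    have k1 : (k : ℝ) < 1 := by
      by_contra! hle
      nlinarith
    norm_cast at k0 k1
    omega
  obtain ⟨t₀, -, hmin⟩ := (isCompact_Icc (a := 0) (b := T)).exists_isMinOn
    (nonempty_Icc.2 hT.le) (Complex.continuous_im.comp hγ).continuousOn
  have hlow : ∀ s, (γ t₀).im ≤ (γ s).im := by
    intro s
    obtain ⟨s', hs', heq⟩ := hper.exists_mem_Ico₀ hT s
    rw [heq]
    exact hmin (Ico_subset_Icc_self hs')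
  set U : Set (ℝ × ℝ) := univ ×ˢ Ioo 0 T with hU
  have hUc : Convex ℝ U := convex_univ.prod (convex_Ioo 0 T)
  obtain ⟨F, hF, hFexp⟩ := exists_continuousOn_log (isOpen_univ.prod isOpen_Ioo) hUc
    ⟨(0, T / 2), mem_univ _, by simp [hT], by simp [hT]⟩
    (D := fun p => γ (p.1 + p.2) - γ p.1) (Continuous.continuousOn (by fun_prop))
    (fun p hp => hchord p.1 p.2 hp.2.1 hp.2.2)
  have hexp : ∀ s ε, 0 < ε → ε < T → Complex.exp (F (s, ε)) = γ (s + ε) - γ s :=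
    fun s ε h0 h1 => hFexp (s, ε) ⟨mem_univ _, h0, h1⟩
  have hloc := fun t => (h t).exists_im_log_chord hγ hT hF hexp
  choose δ hδ0 hδT C hC using hloc
  set ψ : ℝ → ℝ := fun t => C t + (Real.pi - θ t) / 2 with hψ
  have hψF : ∀ t ε, 0 < ε → ε < δ t → (F (t, ε)).im = ψ t :=
    fun t ε h0 h1 => (hC t t ε (by simp [hδ0 t]) h0 h1).1 le_rfl
  have hright : ∀ t, ∀ᶠ s in 𝓝[>] t, ψ s = ψ t := by
    intro t
    filter_upwards [Ioo_mem_nhdsGT (show t < t + δ t by linarith [hδ0 t])] with s hs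
    set ε := min (δ s) (δ t) / 2 with hε
    have h0 : 0 < min (δ s) (δ t) := lt_min (hδ0 s) (hδ0 t)
    rw [← hψF s ε (by linarith) (by linarith [min_le_left (δ s) (δ t)])]
    exact (hC t s ε (abs_lt.2 ⟨by linarith [hs.1, hδ0 t], by linarith [hs.2]⟩) (by linarith)
      (by linarith [min_le_right (δ s) (δ t)])).1 hs.1.le
  have hleft : ∀ t, ∀ᶠ s in 𝓝[<] t, ψ s = ψ t - (Real.pi - θ t) := by
    intro t
    filter_upwards [Ioo_mem_nhdsLT (show t - δ t < t by linarith [hδ0 t])] with s hs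
    -- The bound by `t - s` makes the chord from `s` end before the corner at `t`.
    set ε := min (min (δ s) (δ t)) (t - s) / 2 with hε
    have h0 : 0 < min (min (δ s) (δ t)) (t - s) :=
      lt_min (lt_min (hδ0 s) (hδ0 t)) (by linarith [hs.2])
    have h1 := min_le_left (min (δ s) (δ t)) (t - s)
    have h2 := min_le_right (min (δ s) (δ t)) (t - s)
    have h3 := min_le_left (δ s) (δ t)
    have h4 := min_le_right (δ s) (δ t)
    rw [← hψF s ε (by linarith) (by linarith)]
    rw [(hC t s ε (abs_lt.2 ⟨by linarith [hs.1], by linarith [hs.2, hδ0 t]⟩) (by linarith)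
      (by linarith)).2 (by linarith), hψ]
    ring
  -- exchanging the ends of a chord turns it by the same angle everywhere
  have hswap : ∀ s ε s' ε', 0 < ε → ε < T → 0 < ε' → ε' < T →
      F (s + ε, T - ε) - F (s, ε) = F (s' + ε', T - ε') - F (s', ε') := by
    intro s ε s' ε' h0 h1 h0' h1'
    refine hUc.isPreconnected.eq_of_cexp_eq (w := -1)
      (f := fun p : ℝ × ℝ => F (p.1 + p.2, T - p.2) - F p)
      (x := (s, ε)) (y := (s', ε')) ?_ ?_ ⟨mem_univ _, h0, h1⟩ ⟨mem_univ _, h0', h1'⟩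
    · refine ContinuousOn.sub (hF.comp (Continuous.continuousOn (by fun_prop)) ?_) hF
      rintro p ⟨-, hp0, hp1⟩
      exact ⟨mem_univ _, by linarith, by linarith⟩
    · rintro p ⟨-, hp0, hp1⟩
      have hne := hchord p.1 p.2 hp0 hp1
      rw [Complex.exp_sub, hexp _ _ (by linarith) (by linarith),
        show F p = F (p.1, p.2) from rfl, hexp p.1 p.2 hp0 hp1,
        show p.1 + p.2 + (T - p.2) = p.1 + T by ring, hper p.1, div_eq_iff hne]
      ring
  -- the chords from the lowest point turn by the interior angle there
  have hbase : ∀ ε, 0 < ε → ε < δ t₀ → ∀ ε', 0 < ε' → ε' < T →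
      (∃ c : ℝ, 0 < c ∧ γ (t₀ + ε) - γ t₀ = c * a t₀) →
      (∃ c : ℝ, 0 < c ∧
        γ (t₀ + ε') - γ t₀ = c * (Complex.exp (θ t₀ * Complex.I) * a t₀)) →
      (F (t₀, ε')).im - (F (t₀, ε)).im = θ t₀ := by
    rintro ε h0 h1 ε' h0' h1' ⟨c, hc, hγc⟩ ⟨c', hc', hγc'⟩
    -- No chord from the lowest point points straight down, so along all of them `F` differs from a
    -- principal logarithm by a constant.
    have hslit : ∀ e ∈ Ioo 0 T, (γ (t₀ + e) - γ t₀) / Complex.I ∈ Complex.slitPlane := by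
      intro e he
      have h1 := hlow (t₀ + e)
      have h2 := hchord t₀ e he.1 he.2
      rw [Complex.mem_slitPlane_iff]
      by_contra! hcon
      apply h2
      simp only [Complex.div_I, Complex.neg_re, Complex.neg_im, Complex.mul_I_re, Complex.mul_I_im,
        Complex.sub_im, Complex.sub_re, neg_neg] at hcon
      apply Complex.ext
      · simp only [Complex.sub_re, Complex.zero_re]; linarith [hcon.2]
      · simp only [Complex.sub_im, Complex.zero_im]; linarith [hcon.1]
    have hconst := (isPreconnected_Ioo (a := 0) (b := T)).eq_of_cexp_eq (w := Complex.I)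
      (f := fun e : ℝ => F (t₀, e) - Complex.log ((γ (t₀ + e) - γ t₀) / Complex.I))
      (x := ε') (y := ε) ?_ ?_ ⟨h0', h1'⟩ ⟨h0, h1.trans_le (hδT t₀)⟩
    · have him := congrArg Complex.im hconst
      simp only [Complex.sub_im, Complex.log_im] at him
      rw [hγc, hγc', mul_div_assoc (c : ℂ), mul_div_assoc (c' : ℂ), Complex.arg_real_mul _ hc,
        Complex.arg_real_mul _ hc', (h t₀).arg_entering_of_isLowest hlow hint] at him
      linarith
    · refine ContinuousOn.sub (hF.comp (Continuous.continuousOn (by fun_prop)) ?_)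
        (ContinuousOn.clog (Continuous.continuousOn (by fun_prop)) hslit)
      exact fun e he => ⟨mem_univ _, he⟩
    · intro e he
      have hne := hchord t₀ e he.1 he.2
      rw [Complex.exp_sub, Complex.exp_log (Complex.slitPlane_ne_zero (hslit e he)),
        hexp _ _ he.1 he.2]
      field_simp
  -- It suffices to exchange the ends of a short chord arriving at `t₀`. Passing to a short leaving
  -- chord adds `π - θ t₀`, and lengthening that one to `T - e` adds `θ t₀`.
  have hturn : ∀ s ε, 0 < ε → ε < T → (F (s + ε, T - ε)).im - (F (s, ε)).im = Real.pi := by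
    intro s ε h0 h1
    obtain ⟨-, -, -, η, hη, hγη⟩ := h t₀
    set e := min η (δ t₀) / 2 with he
    have hm : 0 < min η (δ t₀) := lt_min hη (hδ0 t₀)
    have hm1 := min_le_left η (δ t₀)
    have hm2 := min_le_right η (δ t₀)
    have he0 : 0 < e := by linarith
    have heT : e < T := by linarith [hδT t₀]
    have hsw := congrArg Complex.im (hswap s ε (t₀ - e) e h0 h1 he0 heT)
    rw [Complex.sub_im, Complex.sub_im, sub_add_cancel] at hsw
    rw [hsw, (hC t₀ (t₀ - e) e (by rw [sub_sub_cancel_left, abs_neg, abs_of_pos he0]; linarith)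
      he0 (by linarith)).2 (by linarith)]
    have hb := hbase e he0 (by linarith) (T - e) (by linarith) (by linarith)
      ⟨e, he0, by rw [(hγη e he0.le (by linarith)).1]; ring⟩
      ⟨e, he0, by
        rw [show t₀ + (T - e) = t₀ - e + T by ring, hper, (hγη e he0.le (by linarith)).2]; ring⟩
    rw [hψF t₀ e he0 (by linarith), hψ] at hb
    simp only at hb
    linarith
  -- Two exchanges take `(t₀, ε)` to `(t₀ + ε, T - ε)` and on to `(t₀ + T, ε)`.
  have htotal : ψ (t₀ + T) - ψ t₀ = 2 * Real.pi := by
    set ε := min (δ t₀) (δ (t₀ + T)) / 2 with hε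
    have hm : 0 < min (δ t₀) (δ (t₀ + T)) := lt_min (hδ0 _) (hδ0 _)
    have hm1 := min_le_left (δ t₀) (δ (t₀ + T))
    have hm2 := min_le_right (δ t₀) (δ (t₀ + T))
    have hεT : ε < T := by linarith [hδT t₀]
    rw [← hψF t₀ ε (by linarith) (by linarith), ← hψF (t₀ + T) ε (by linarith) (by linarith)]
    have h1 := hturn t₀ ε (by linarith) hεT
    have h2 := hturn (t₀ + ε) (T - ε) (by linarith) (by linarith)
    rw [show t₀ + ε + (T - ε) = t₀ + T by ring, sub_sub_cancel] at h2
    linarith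
  refine ⟨t₀, fun S hS => ?_⟩
  rw [← htotal, sub_eq_sum_jumps (j := fun t => Real.pi - θ t) (by linarith) S
    (fun t ht => ((hS t).1 ht).1) ?_ hright hleft]
  intro t ht htS
  by_contra hne
  exact htS ((hS t).2 ⟨ht, fun heq => hne (by simp [heq])⟩)

/-! ### From corner parameters to non-euclidean points. -/

/-- The curve is injective on the half-open period `(t₀, t₀ + T]`, so each non-euclidean point is
the image of exactly one parameter there with angle different from `π`, and the two sums agree term
by term. -/
theorem theorem4p2p4 (G : PlanarMapGeometry) (L : ℝ → ℂ) (hL : IsMLine G L)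
    (hclosed : IsSimplyClosed L) (hint : HasInteriorAngles L)
    (n : ℕ) (x : Fin n → ℂ) (hx : Function.Injective x)
    (hrange : Set.range x = nonEuclideanPoints G L) :
    curvature G L = ∑ i, (Real.pi - G.angle (x i)) ∧ curvature G L = 2 * Real.pi := by
  have hsum : curvature G L = ∑ i, (Real.pi - G.angle (x i)) := by
    rw [curvature, ← hrange, finsum_mem_range hx, finsum_eq_sum_of_fintype]
  refine ⟨hsum, hsum.trans ?_⟩
  obtain ⟨T, hT, hper, hsimple⟩ := hclosed
  choose a ha using hL
  obtain ⟨t₀, ht₀⟩ := exists_sum_exterior_angles_eq ha hT hper hsimple hint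
  have hpre : ∀ i, ∃ t ∈ Ioc t₀ (t₀ + T), L t = x i := by
    intro i
    obtain ⟨⟨s, hs⟩, -⟩ : x i ∈ nonEuclideanPoints G L := hrange ▸ mem_range_self i
    obtain ⟨t, ht, hst⟩ := hper.exists_mem_Ioc hT s t₀
    exact ⟨t, ht, hst ▸ hs⟩
  choose τ hτ hLτ using hpre
  have hτinj : Function.Injective τ := fun i i' hii => hx (by rw [← hLτ, ← hLτ, hii])
  rw [← ht₀ (Finset.univ.image τ) ?_, Finset.sum_image hτinj.injOn]
  · exact Finset.sum_congr rfl fun i _ => by rw [hLτ]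
  intro t
  simp only [Finset.mem_image, Finset.mem_univ, true_and]
  constructor
  · rintro ⟨i, rfl⟩
    refine ⟨hτ i, ?_⟩
    rw [hLτ]
    exact (show x i ∈ nonEuclideanPoints G L from hrange ▸ mem_range_self i).2
  · rintro ⟨ht, hne⟩
    obtain ⟨i, hi⟩ : L t ∈ range x := hrange ▸ ⟨mem_range_self t, hne⟩
    refine ⟨i, ?_⟩
    obtain ⟨k, hk⟩ := hsimple t (τ i) (by rw [hLτ, hi])
    have hτi := hτ i
    -- Two parameters in one half-open period differ by less than `T`, so the integer `k` is zero.
    have k0 : (-1 : ℝ) < k := by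
      by_contra! hle
      nlinarith [ht.2, hτi.1]
    have k1 : (k : ℝ) < 1 := by
      by_contra! hle
      nlinarith [ht.1, hτi.2]
    have hk0 : k = 0 := by
      norm_cast at k0 k1
      omega
    simpa [hk0] using hk
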